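/- For a Tychonoff space $X$ and a compact subset $K\subseteq X$, let $\operatorname{Homeo}_K(X)$ be the group of homeomorphisms of $X$ that are the identity on $X\setminus K$, equipped with the compact-open topology, and let $\operatorname{Homeo}_{cpt}(X)=\bigcup_{K}\operatorname{Homeo}_K(X)$, the union being over all compact $K\subseteq X$. The space $X$ is said to have the Compactly Supported Homeomorphism Property (CSHP) if the finest topology on $\operatorname{Homeo}_{cpt}(X)$ making all the inclusions $\operatorname{Homeo}_K(X)\to\operatorname{Homeo}_{cpt}(X)$ continuous coincides with the topology induced on $\operatorname{Homeo}_{cpt}(X)$ by the embedding of $\operatorname{Homeo}(X)$ into $\operatorname{Homeo}(\beta X)$, where $\beta X$ is the Stone-Čech compactification of $X$, $\operatorname{Homeo}(\beta X)$ carries the compact-open topology, and each homeomorphism of $X$ is sent to its unique extension to $\beta X$. Let $\alpha\le\beta$ be infinite ordinals, each equipped with its order topology. The disjoint union (coproduct) $\alpha\amalg\beta$ has CSHP if and only if one of the following conditions holds: (a) $\alpha$ and $\beta$ are both successor ordinals; or (b) $\beta$ is an uncountable regular cardinal, and in addition $\alpha=\beta$ or $\alpha$ is a successor ordinal. -/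

import Mathlib

universe u

namespace CSHPDefs

/-- The compact-open topology on the set of self-homeomorphisms of `X`. -/
abbrev compactOpen (X : Type*) [TopologicalSpace X] : TopologicalSpace (X ≃ₜ X) :=
  TopologicalSpace.induced (fun h : X ≃ₜ X => (h : C(X, X))) ContinuousMap.compactOpen

/-- The group of homeomorphisms of `X` that are the identity outside `K`. -/
def HomeoOn {X : Type*} [TopologicalSpace X] (K : Set X) : Subgroup (X ≃ₜ X) where
  carrier := {h | ∀ x, x ∉ K → h x = x}
  mul_mem' := by
    intro a b ha hb x hx
    rw [Homeomorph.mul_apply, hb x hx, ha x hx]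
  one_mem' := fun _ _ => rfl
  inv_mem' := by
    intro a ha x hx
    rw [Homeomorph.inv_apply, Homeomorph.symm_apply_eq, ha x hx]

/-- The group of compactly supported homeomorphisms of `X`: the union of the groups
`HomeoOn K` over all compact subsets `K` of `X`. -/
def HomeoCpt (X : Type*) [TopologicalSpace X] : Subgroup (X ≃ₜ X) where
  carrier := ⋃ K : TopologicalSpace.Compacts X, (HomeoOn (K : Set X) : Set (X ≃ₜ X))
  mul_mem' := by
    intro a b ha hb
    obtain ⟨K, hK⟩ := Set.mem_iUnion.1 ha
    obtain ⟨L, hL⟩ := Set.mem_iUnion.1 hb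
    refine Set.mem_iUnion.2 ⟨K ⊔ L, (HomeoOn _).mul_mem ?_ ?_⟩
    · exact fun x hx => hK x fun h => hx (Or.inl h)
    · exact fun x hx => hL x fun h => hx (Or.inr h)
  one_mem' := Set.mem_iUnion.2 ⟨⊥, (HomeoOn _).one_mem⟩
  inv_mem' := by
    intro a ha
    obtain ⟨K, hK⟩ := Set.mem_iUnion.1 ha
    exact Set.mem_iUnion.2 ⟨K, (HomeoOn _).inv_mem hK⟩

/-- The inclusion of `HomeoOn K`, for `K` compact, into `HomeoCpt X`. -/
def incl {X : Type*} [TopologicalSpace X] (K : TopologicalSpace.Compacts X) :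
    HomeoOn (K : Set X) → HomeoCpt X :=
  fun h => ⟨h.1, Set.mem_iUnion.2 ⟨K, h.2⟩⟩

/-- The topology of `HomeoOn K`: the subspace topology of the compact-open topology. -/
abbrev homeoOnTopology {X : Type*} [TopologicalSpace X] (K : Set X) :
    TopologicalSpace (HomeoOn K) :=
  TopologicalSpace.induced Subtype.val (compactOpen X)

/-- The finest topology on `HomeoCpt X` for which all the inclusions of the `HomeoOn K`,
`K` compact, are continuous (in Mathlib's order on topologies, finer means smaller, so this is a
supremum of coinduced topologies). -/
abbrev colimTopology (X : Type*) [TopologicalSpace X] : TopologicalSpace (HomeoCpt X) :=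
  ⨆ K : TopologicalSpace.Compacts X,
    TopologicalSpace.coinduced (incl K) (homeoOnTopology (K : Set X))

/-- The extension of a continuous self-map of `X` to the Stone–Čech compactification. -/
noncomputable def stoneCechMap {X : Type*} [TopologicalSpace X] (f : C(X, X)) :
    StoneCech X → StoneCech X :=
  stoneCechExtend (continuous_stoneCechUnit.comp f.continuous)

theorem stoneCechMap_leftInverse {X : Type*} [TopologicalSpace X] (f g : C(X, X))
    (h : Function.LeftInverse g f) :
    Function.LeftInverse (stoneCechMap g) (stoneCechMap f) := by
  refine congrFun (stoneCech_hom_ext (g₁ := stoneCechMap g ∘ stoneCechMap f) (g₂ := id)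
    ((continuous_stoneCechExtend _).comp (continuous_stoneCechExtend _)) continuous_id ?_)
  funext x
  simp [stoneCechMap, stoneCechExtend_stoneCechUnit, h x]

/-- The extension of a self-homeomorphism of `X` to the Stone–Čech compactification. -/
noncomputable def stoneCechHomeo {X : Type*} [TopologicalSpace X] (h : X ≃ₜ X) :
    StoneCech X ≃ₜ StoneCech X where
  toFun := stoneCechMap (h : C(X, X))
  invFun := stoneCechMap (h.symm : C(X, X))
  left_inv := stoneCechMap_leftInverse _ _ h.symm_apply_apply
  right_inv := stoneCechMap_leftInverse _ _ h.apply_symm_apply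
  continuous_toFun := continuous_stoneCechExtend _
  continuous_invFun := continuous_stoneCechExtend _

/-- The topology on `HomeoCpt X` induced by the homeomorphism group, with the compact-open
topology, of the Stone–Čech compactification of `X`. -/
noncomputable abbrev stoneCechTopology (X : Type*) [TopologicalSpace X] :
    TopologicalSpace (HomeoCpt X) :=
  TopologicalSpace.induced (fun h : HomeoCpt X => stoneCechHomeo (h : X ≃ₜ X))
    (compactOpen (StoneCech X))

/-- The Compactly Supported Homeomorphism Property (of a Tychonoff space `X`). -/
def CSHP (X : Type*) [TopologicalSpace X] : Prop :=
  colimTopology X = stoneCechTopology X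

/-- `β` is (the initial ordinal of) an uncountable regular cardinal. -/
def IsUncountableRegularCardinal (β : Ordinal.{u}) : Prop :=
  ∃ κ : Cardinal.{u}, Cardinal.aleph0 < κ ∧ κ.IsRegular ∧ β = κ.ord

/-- `α` is a successor ordinal. -/
def IsSuccessor (α : Ordinal.{u}) : Prop :=
  ∃ γ : Ordinal.{u}, α = Order.succ γ

end CSHPDefs

/-! The colimit topology is always finer than the Stone–Čech one
(`colimTopology_le_stoneCechTopology`), so CSHP asks whether every colimit-open set is Stone–Čech
open.

Failure comes from `not_cshp_of_isolated`. Isolated points `z i` leave every compact set, and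
transpositions of `z i` and `z j` are composed with homeomorphisms `g i` close to the identity. A
Stone–Čech neighbourhood of `1` sees the `z i` only through a finite colouring, so by pigeonhole it
contains such a product. On a compact set, the value of `g i` at one isolated point records `i`,
which makes the set of products closed in the colimit. For a limit summand of countable cofinality,
`g i = 1` works. If its cofinality `κ` is uncountable and `κ.ord < β`, the maps `blockSwap` supply
`g i` tending to the identity around the point `κ.ord` of `β`.

Success rests on finitely many cuts `x ≤ a`: respecting them is a Stone–Čech open condition
(`sameSide_mem_nhds`) that is fine enough on each `HomeoOn K` (`exists_sameSide_of_isOpen`). For two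
successors the whole space is compact. For `β` regular and uncountable, a counterexample chosen for
each finite set of cuts leads, by closing off below some `γ < β`, to a contradiction inside one
compact set. -/

namespace CSHPDefs

open Set Filter Topology Uniformity

/-! ### Neighbourhoods in the Stone–Čech topology -/

section StoneCech

variable {X : Type u} [TopologicalSpace X]

theorem stoneCechHomeo_stoneCechUnit (h : X ≃ₜ X) (x : X) :
    stoneCechHomeo h (stoneCechUnit x) = stoneCechUnit (h x) :=
  stoneCechExtend_stoneCechUnit (continuous_stoneCechUnit.comp h.continuous) x

/-- Closeness of two extended homeomorphisms can be tested on `X`. -/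
theorem forall_stoneCechHomeo_mem {V : Set (StoneCech X × StoneCech X)} (hV : IsClosed V)
    {g h : X ≃ₜ X} (hgh : ∀ x, (stoneCechUnit (g x), stoneCechUnit (h x)) ∈ V)
    (y : StoneCech X) : (stoneCechHomeo g y, stoneCechHomeo h y) ∈ V := by
  have hcl : IsClosed {y : StoneCech X | (stoneCechHomeo g y, stoneCechHomeo h y) ∈ V} :=
    hV.preimage ((stoneCechHomeo g).continuous.prodMk (stoneCechHomeo h).continuous)
  have : closure (range (stoneCechUnit : X → StoneCech X)) ⊆
      {y | (stoneCechHomeo g y, stoneCechHomeo h y) ∈ V} := by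
    refine closure_minimal ?_ hcl
    rintro _ ⟨x, rfl⟩
    simpa only [mem_ofPred_eq, stoneCechHomeo_stoneCechUnit] using hgh x
  exact this (denseRange_stoneCechUnit y)

theorem continuous_homeoOn_toContinuousMap (K : Set X) :
    Continuous[homeoOnTopology K, _] fun h : HomeoOn K => ((h : X ≃ₜ X) : C(X, X)) :=
  let := compactOpen X
  Continuous.comp (@continuous_induced_dom (X ≃ₜ X) C(X, X) (fun h => (h : C(X, X))) _)
    (@continuous_induced_dom _ _ Subtype.val (compactOpen X))

/-- On `HomeoOn K`, compact-open convergence is uniform on `K` after mapping to `StoneCech X`. Off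
`K` all maps agree, and closed entourages carry the estimate from the dense image of `X` to all of
`StoneCech X`. -/
theorem colimTopology_le_stoneCechTopology : colimTopology X ≤ stoneCechTopology X := by
  let := uniformSpaceOfCompactR1 (γ := StoneCech X)
  refine iSup_le fun K => ?_
  rw [coinduced_le_iff_le_induced, stoneCechTopology, compactOpen, induced_compose, induced_compose,
    ← continuous_iff_le_induced]
  let := homeoOnTopology (K : Set X)
  have hc' := (ContinuousMap.continuous_postcomp
    (⟨stoneCechUnit, continuous_stoneCechUnit⟩ : C(X, StoneCech X))).comp
      (continuous_homeoOn_toContinuousMap (K : Set X))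
  rw [continuous_iff_continuousAt] at hc' ⊢
  intro h₀
  refine ContinuousMap.tendsto_iff_tendstoUniformly.2 fun W hW => ?_
  obtain ⟨V, ⟨hV, hVc⟩, hVW⟩ := uniformity_hasBasis_closed.mem_iff.1 hW
  have := ContinuousMap.tendsto_iff_forall_isCompact_tendstoUniformlyOn.1 (hc' h₀) K K.isCompact V hV
  filter_upwards [this] with h hh y
  refine hVW (forall_stoneCechHomeo_mem hVc (fun x => ?_) y)
  by_cases hx : x ∈ (K : Set X)
  · exact hh x hx
  · have e₁ : (h₀ : X ≃ₜ X) x = x := h₀.2 x hx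
    have e₂ : (h : X ≃ₜ X) x = x := h.2 x hx
    simp only [incl, e₁, e₂]
    exact refl_mem_uniformity hV

/-- A neighbourhood of the identity in the Stone–Čech topology contains all the homeomorphisms
that respect a suitable finite colouring up to a suitable neighbourhood of the diagonal. -/
theorem exists_coloring_of_mem_nhds_one {U : Set (HomeoCpt X)}
    (hU : U ∈ @nhds _ (stoneCechTopology X) 1) :
    ∃ (ι : Type u) (_ : Finite ι) (c : X → ι) (V : Set (X × X)), (∀ x, V ∈ 𝓝 (x, x)) ∧
      ∀ h : HomeoCpt X, (∀ x, c ((h : X ≃ₜ X) x) = c x ∨ (x, (h : X ≃ₜ X) x) ∈ V) → h ∈ U := by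
  let := uniformSpaceOfCompactR1 (γ := StoneCech X)
  let := compactOpen (StoneCech X)
  rw [nhds_induced, nhds_induced] at hU
  obtain ⟨T, ⟨S, hS, hST⟩, hTU⟩ := hU
  obtain ⟨W, hW, hWS⟩ := (nhds_basis_uniformity'
    ContinuousMap.hasBasis_compactConvergenceUniformity_of_compact).mem_iff.1 hS
  obtain ⟨V, ⟨hV, hVc⟩, hVW⟩ := uniformity_hasBasis_closed.mem_iff.1 hW
  -- A colour is a point of a finite `R`-net, so two points of equal colour are `V`-close.
  obtain ⟨R, hR, hRs, hRV⟩ := comp_symm_mem_uniformity_sets hV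
  obtain ⟨t, ht⟩ := finite_cover_nhds fun y : StoneCech X =>
    (mem_nhds_left y hR : {z | (y, z) ∈ R} ∈ 𝓝 y)
  have hcov : ∀ x : X, ∃ y : t, (y.1, stoneCechUnit x) ∈ R := fun x => by
    have hx : stoneCechUnit x ∈ ⋃ y ∈ t, {z | (y, z) ∈ R} := ht ▸ mem_univ _
    simp only [mem_iUnion] at hx
    obtain ⟨y, hy, hyx⟩ := hx
    exact ⟨⟨y, hy⟩, hyx⟩
  choose c hc using hcov
  refine ⟨t, inferInstance, c, Prod.map stoneCechUnit stoneCechUnit ⁻¹' V, fun x => ?_,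
    fun h hh => hTU (hST (hWS fun y => hVW (forall_stoneCechHomeo_mem (g := 1) hVc (fun x => ?_) y)))⟩
  · have h₁ : V ∈ 𝓝 (stoneCechUnit x, stoneCechUnit x) := nhds_le_uniformity _ hV
    exact (continuous_stoneCechUnit.prodMap continuous_stoneCechUnit).continuousAt.preimage_mem_nhds h₁
  · rcases hh x with hx | hx
    · exact hRV ⟨(c x).1, hRs.symm _ _ (hc x), hx ▸ hc _⟩
    · exact hx

/-- Agreement modulo a clopen set is an open condition in the Stone–Čech topology. -/
theorem setOf_mem_iff_mem_nhds (h₀ : HomeoCpt X) {D : Set X} (hD : IsClopen D) :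
    {h : HomeoCpt X | ∀ x, (h : X ≃ₜ X) x ∈ D ↔ (h₀ : X ≃ₜ X) x ∈ D} ∈
      @nhds _ (stoneCechTopology X) h₀ := by
  let := compactOpen (StoneCech X)
  have hb := (continuous_boolIndicator_iff_isClopen D).2 hD
  -- The indicator of `D` extends, so agreement modulo `D` becomes two conditions sending a compact
  -- set into an open one.
  let φ : StoneCech X → Bool := stoneCechExtend hb
  have hφ : Continuous φ := continuous_stoneCechExtend hb
  have hφD : ∀ x, φ (stoneCechUnit x) = true ↔ x ∈ D := fun x => by
    rw [show φ (stoneCechUnit x) = D.boolIndicator x from stoneCechExtend_stoneCechUnit hb x,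
      Set.mem_iff_boolIndicator]
  let H₀ := stoneCechHomeo (h₀ : X ≃ₜ X)
  let C : Bool → Set (StoneCech X) := fun b => φ ⁻¹' {b}
  have hC : ∀ b, IsClopen (C b) := fun b => (isClopen_discrete {b}).preimage hφ
  have hopen : ∀ b, {f : C(StoneCech X, StoneCech X) | MapsTo f (H₀ ⁻¹' C b) (C b)} ∈
      𝓝 (H₀ : C(StoneCech X, StoneCech X)) := fun b =>
    (ContinuousMap.isOpen_setOfPred_mapsTo ((hC b).1.preimage H₀.continuous).isCompact
      (hC b).2).mem_nhds fun y hy => hy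
  rw [nhds_induced, nhds_induced]
  refine ⟨_, ⟨_, inter_mem (hopen true) (hopen false), subset_rfl⟩, fun h hh x => ?_⟩
  have key : ∀ b, φ (stoneCechUnit ((h₀ : X ≃ₜ X) x)) = b →
      φ (stoneCechUnit ((h : X ≃ₜ X) x)) = b := by
    intro b hb
    have hm : MapsTo (stoneCechHomeo (h : X ≃ₜ X)) (H₀ ⁻¹' C b) (C b) := by
      cases b
      exacts [hh.2, hh.1]
    have := hm (x := stoneCechUnit x) (by simpa [C, H₀, stoneCechHomeo_stoneCechUnit] using hb)
    simpa [C, stoneCechHomeo_stoneCechUnit] using this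
  rw [← hφD, ← hφD, key _ rfl]

end StoneCech

/-! ### Criteria for the failure of CSHP -/

section Criterion

variable {X : Type u} [TopologicalSpace X]

/-- Such a `B` is closed in the colimit topology, yet `1` lies in its Stone–Čech closure. -/
theorem not_cshp_of_isClosed {B : Set (HomeoCpt X)} (hB₁ : 1 ∉ B)
    (hB : ∀ K : TopologicalSpace.Compacts X,
      IsClosed[homeoOnTopology (K : Set X)] (incl K ⁻¹' B))
    (happrox : ∀ (ι : Type u) [Finite ι] (c : X → ι) (V : Set (X × X)), (∀ x, V ∈ 𝓝 (x, x)) →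
      ∃ b ∈ B, ∀ x, c ((b : X ≃ₜ X) x) = c x ∨ (x, (b : X ≃ₜ X) x) ∈ V) :
    ¬ CSHP X := by
  intro hX
  have hcl : IsClosed[colimTopology X] B := by
    simp only [isClosed_iSup_iff, isClosed_coinduced]
    exact hB
  rw [show colimTopology X = stoneCechTopology X from hX] at hcl
  obtain ⟨ι, _, c, V, hV, h⟩ := exists_coloring_of_mem_nhds_one
    (@IsOpen.mem_nhds _ (stoneCechTopology X) _ _ hcl.isOpen_compl hB₁)
  obtain ⟨b, hb, hbV⟩ := happrox ι c V hV
  exact h b hbV hb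

theorem continuous_homeoOn_apply (K : Set X) (x : X) :
    Continuous[homeoOnTopology K, _] fun h : HomeoOn K => (h : X ≃ₜ X) x := by
  let := homeoOnTopology K
  exact (continuous_eval_const (F := C(X, X)) x).comp (continuous_homeoOn_toContinuousMap K)

/-- The value at an isolated point is locally constant, since homeomorphisms send isolated points to
isolated points. So `h₀` has a neighbourhood meeting `A` in a finite set, which can be removed in a
T1 space. -/
theorem isClosed_of_finite_near [T1Space X] {K : Set X} {A : Set (HomeoOn K)}
    (hA : ∀ h₀ : HomeoOn K, ∃ S : Set X, S.Finite ∧ (∀ x ∈ S, IsOpen {x}) ∧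
      {b ∈ A | ∀ x ∈ S, (b : X ≃ₜ X) x = (h₀ : X ≃ₜ X) x}.Finite) :
    IsClosed[homeoOnTopology K] A := by
  let := homeoOnTopology K
  have : T1Space (HomeoOn K) := by
    refine t1Space_of_injective_of_continuous (f := fun (h : HomeoOn K) x => (h : X ≃ₜ X) x)
      (fun g h hgh => Subtype.ext (Homeomorph.ext (congrFun hgh)))
      (continuous_pi (continuous_homeoOn_apply K))
  refine isOpen_compl_iff.1 (isOpen_iff_mem_nhds.2 fun h₀ hh₀ => ?_)
  obtain ⟨S, hS, hSo, hfin⟩ := hA h₀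
  have hN : {h : HomeoOn K | ∀ x ∈ S, (h : X ≃ₜ X) x = (h₀ : X ≃ₜ X) x} ∈ 𝓝 h₀ := by
    refine (eventually_all_finite hS).2 fun x hx => ?_
    have ho : IsOpen {(h₀ : X ≃ₜ X) x} := by
      simpa using (h₀ : X ≃ₜ X).isOpenMap _ (hSo x hx)
    exact (continuous_homeoOn_apply K x).continuousAt.eventually (ho.mem_nhds rfl)
  filter_upwards [hN, hfin.isClosed.isOpen_compl.mem_nhds fun h => hh₀ h.1] with h h₁ h₂ h₃
  exact h₂ ⟨h₃, h₁⟩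

open Classical in
/-- The homeomorphism exchanging two isolated points. -/
noncomputable def swapHomeo [T1Space X] {x y : X} (hx : IsOpen {x}) (hy : IsOpen {y}) :
    X ≃ₜ X :=
  have hc : Continuous (Equiv.swap x y) := by
    refine continuous_iff_continuousAt.2 fun z => ?_
    by_cases hzx : z = x
    · subst hzx
      rw [ContinuousAt, isOpen_singleton_iff_nhds_eq_pure _ |>.1 hx]
      exact tendsto_pure_left.2 fun s hs => mem_of_mem_nhds hs
    by_cases hzy : z = y
    · subst hzy
      rw [ContinuousAt, isOpen_singleton_iff_nhds_eq_pure _ |>.1 hy]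
      exact tendsto_pure_left.2 fun s hs => mem_of_mem_nhds hs
    refine continuousAt_id.congr ?_
    filter_upwards [isOpen_ne.mem_nhds hzx, isOpen_ne.mem_nhds hzy] with w h₁ h₂
    exact (Equiv.swap_apply_of_ne_of_ne h₁ h₂).symm
  { Equiv.swap x y with
    continuous_toFun := hc
    continuous_invFun := hc }

section swapHomeo

variable [T1Space X] {x y : X} (hx : IsOpen {x}) (hy : IsOpen {y})

open Classical in
theorem swapHomeo_apply (z : X) : swapHomeo hx hy z = Equiv.swap x y z := rfl

theorem swapHomeo_left : swapHomeo hx hy x = y := by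
  classical rw [swapHomeo_apply, Equiv.swap_apply_left]

theorem swapHomeo_right : swapHomeo hx hy y = x := by
  classical rw [swapHomeo_apply, Equiv.swap_apply_right]

theorem swapHomeo_of_ne {z : X} (h₁ : z ≠ x) (h₂ : z ≠ y) : swapHomeo hx hy z = z := by
  classical rw [swapHomeo_apply, Equiv.swap_apply_of_ne_of_ne h₁ h₂]

end swapHomeo

/-- Suppose that isolated points `z i` leave every compact set, and that the compactly supported
homeomorphisms `g i` fix all of them, approach the identity, and are told apart on every compact
set by their value at one isolated point. Then the products of the `g i` with transpositions of
the `z i` prevent `X` from having the CSHP. -/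
theorem not_cshp_of_isolated [T1Space X] {I : Type*} (z : I → X) (hz : Function.Injective z)
    (hzo : ∀ i, IsOpen {z i}) (g : I → X ≃ₜ X) (hg : ∀ i, g i ∈ HomeoCpt X)
    (hgz : ∀ i j, g i (z j) = z j)
    (hK : ∀ K : Set X, IsCompact K → (z ⁻¹' K).Finite ∨
      ∃ f : X, IsOpen {f} ∧ (∀ i ∈ z ⁻¹' K, g i f ∉ range z) ∧ InjOn (fun i => g i f) (z ⁻¹' K))
    (hV : ∀ V : Set (X × X), (∀ x, V ∈ 𝓝 (x, x)) → {i | ∀ x, (x, g i x) ∈ V}.Infinite) :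
    ¬ CSHP X := by
  let b : I → I → X ≃ₜ X := fun i j => swapHomeo (hzo i) (hzo j) * g i
  have hb : ∀ i j, b i j (z i) = z j := fun i j => by
    simp only [b, Homeomorph.mul_apply, hgz, swapHomeo_left]
  have hb' : ∀ i j, b i j (z j) = z i := fun i j => by
    simp only [b, Homeomorph.mul_apply, hgz, swapHomeo_right]
  have hbf : ∀ i j x, g i x ∉ range z → b i j x = g i x := fun i j x hx => by
    simp only [b, Homeomorph.mul_apply]
    exact swapHomeo_of_ne _ _ (fun h => hx ⟨i, h.symm⟩) (fun h => hx ⟨j, h.symm⟩)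
  have hbK : ∀ {K : Set X} {i j}, i ≠ j → b i j ∈ HomeoOn K → i ∈ z ⁻¹' K ∧ j ∈ z ⁻¹' K := by
    intro K i j hij h
    refine ⟨by_contra fun hi => hij ?_, by_contra fun hj => hij ?_⟩
    · exact hz ((h _ hi).symm.trans (hb i j))
    · exact hz ((hb' i j).symm.trans (h _ hj))
  refine not_cshp_of_isClosed (B := {h | ∃ i j, i ≠ j ∧ (h : X ≃ₜ X) = b i j}) ?_ ?_ ?_
  · rintro ⟨i, j, hij, h⟩
    refine hij (hz ?_)
    rw [← hb i j, ← h]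
    rfl
  · intro K
    refine isClosed_of_finite_near fun h₀ => ?_
    rcases hK K K.isCompact with hfin | ⟨f, hf, hfz, hinj⟩
    · refine ⟨∅, finite_empty, by simp, ?_⟩
      refine Finite.of_finite_image (f := Subtype.val)
        (((hfin.prod hfin).image fun p => b p.1 p.2).subset ?_) Subtype.val_injective.injOn
      rintro _ ⟨h, ⟨⟨i, j, hij, hh⟩, -⟩, rfl⟩
      have hm : b i j ∈ HomeoOn (K : Set X) := hh ▸ h.2
      exact ⟨(i, j), hbK hij hm, hh.symm⟩
    · by_cases hi : ∃ i ∈ z ⁻¹' K, g i f = (h₀ : X ≃ₜ X) f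
      · obtain ⟨i, hiK, hif⟩ := hi
        -- The value at `f` determines the first index `i`; the value at `z i` then determines `j`.
        refine ⟨{f, z i}, by simp, by simp [hf, hzo i], ?_⟩
        refine Set.Subsingleton.finite ?_
        have key : ∀ h : HomeoOn (K : Set X), (∃ i j, i ≠ j ∧ (h : X ≃ₜ X) = b i j) →
            (∀ x ∈ ({f, z i} : Set X), (h : X ≃ₜ X) x = (h₀ : X ≃ₜ X) x) →
            ∃ j, z j = (h₀ : X ≃ₜ X) (z i) ∧ (h : X ≃ₜ X) = b i j := by
          rintro h ⟨i', j, hij, hh⟩ hS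
          have hm : b i' j ∈ HomeoOn (K : Set X) := hh ▸ h.2
          have hiK' := (hbK hij hm).1
          have e : i' = i := by
            refine hinj hiK' hiK ?_
            change g i' f = g i f
            rw [← hbf i' j f (hfz i' hiK'), ← hh, hif]
            exact hS f (by simp)
          subst e
          exact ⟨j, by rw [← hS (z i') (by simp), hh, hb], hh⟩
        rintro h ⟨h₁, h₂⟩ h' ⟨h₁', h₂'⟩
        obtain ⟨j, hj, hh⟩ := key h h₁ h₂
        obtain ⟨j', hj', hh'⟩ := key h' h₁' h₂'
        rw [Subtype.ext_iff, hh, hh', hz (hj.trans hj'.symm)]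
      · refine ⟨{f}, finite_singleton f, by simp [hf], ?_⟩
        convert finite_empty
        refine eq_empty_of_forall_notMem ?_
        rintro h ⟨⟨i, j, hij, hh⟩, hS⟩
        have hm : b i j ∈ HomeoOn (K : Set X) := hh ▸ h.2
        refine hi ⟨i, (hbK hij hm).1, ?_⟩
        rw [← hS f rfl, ← hbf i j f (hfz i (hbK hij hm).1), ← hh]
        rfl
  · intro ι _ c V hVx
    -- Pigeonhole: among infinitely many `i` with `g i` within `V` of the identity, two have `z i`
    -- and `z j` of the same colour.
    obtain ⟨i, hi, j, hj, hij, hc⟩ := (hV V hVx).exists_ne_map_eq_of_mapsTo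
      (f := fun i => c (z i)) (mapsTo_univ _ _) finite_univ
    have hmem : b i j ∈ HomeoCpt X := by
      refine mul_mem (mem_iUnion.2 ⟨⟨{z i, z j}, (Set.toFinite _).isCompact⟩, fun x hx => ?_⟩) (hg i)
      refine swapHomeo_of_ne _ _ ?_ ?_ <;> rintro rfl <;> simp at hx
    refine ⟨⟨b i j, hmem⟩, ⟨i, j, hij, rfl⟩, fun x => ?_⟩
    by_cases hxi : x = z i
    · exact Or.inl (by simpa [hxi, hb] using hc.symm)
    by_cases hxj : x = z j
    · exact Or.inl (by simpa [hxj, hb'] using hc)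
    right
    have : b i j x = g i x := by
      simp only [b, Homeomorph.mul_apply]
      refine swapHomeo_of_ne _ _ (fun h => hxi ?_) (fun h => hxj ?_)
      · exact (g i).injective (h.trans (hgz i i).symm)
      · exact (g i).injective (h.trans (hgz i j).symm)
    simpa [this] using hi x

end Criterion

/-! ### Involutions preserving the blocks between consecutive powers of `ω` -/

section BlockSwap

open Ordinal

/-- The largest power of `ω` that is at most `x` (for `x ≠ 0`). -/
noncomputable def leadingPower (x : Ordinal.{u}) : Ordinal.{u} :=
  ω ^ log ω x

theorem leadingPower_le {x : Ordinal.{u}} (hx : x ≠ 0) : leadingPower x ≤ x :=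
  opow_log_le_self ω hx

theorem leadingPower_pos (x : Ordinal.{u}) : 0 < leadingPower x :=
  opow_pos _ omega0_pos

theorem leadingPower_mono : Monotone (leadingPower : Ordinal.{u} → Ordinal.{u}) := fun _ _ h =>
  opow_le_opow_right omega0_pos (log_mono_right ω h)

theorem lt_of_leadingPower_lt {l y : Ordinal.{u}} (h : leadingPower l < leadingPower y) :
    l < leadingPower y := by
  have hlog : log ω l < log ω y :=
    lt_of_not_ge fun h' => h.not_ge (opow_le_opow_right omega0_pos h')
  exact (lt_opow_succ_log_self one_lt_omega0 l).trans_le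
    (opow_le_opow_right omega0_pos (Order.succ_le_of_lt hlog))

theorem leadingPower_eq {ζ y : Ordinal.{u}} (h₁ : ω ^ ζ ≤ y) (h₂ : y < ω ^ Order.succ ζ) :
    leadingPower y = ω ^ ζ := by
  have hy : y ≠ 0 := fun h => by
    rw [h] at h₁
    exact (opow_pos ζ omega0_pos).not_ge h₁
  rw [leadingPower]
  congr 1
  refine le_antisymm ?_ ?_
  · exact Order.lt_succ_iff.1 ((lt_opow_iff_log_lt one_lt_omega0 hy).1 h₂)
  · exact (opow_le_iff_le_log one_lt_omega0 hy).1 h₁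

theorem leadingPower_add {i x : Ordinal.{u}} {j : Ordinal.{u}} (hi : i < leadingPower x)
    (hj : j < ω) : leadingPower (leadingPower x + i + j) = leadingPower x := by
  refine leadingPower_eq (by rw [add_assoc]; exact le_self_add) ?_
  have hp := isPrincipal_add_omega0_opow (Order.succ (log ω x))
  have h₁ : leadingPower x < ω ^ Order.succ (log ω x) :=
    (opow_lt_opow_iff_right one_lt_omega0).2 (Order.lt_succ _)
  refine hp (hp h₁ (hi.trans h₁)) (hj.trans_le ?_)
  exact left_le_opow ω (Order.bot_lt_succ _)

open Classical in
/-- The involution of the ordinals that exchanges `ω ^ ζ + 1` and `ω ^ ζ + i + 2` for all `ζ` with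
`i < ω ^ ζ`, as far as this concerns ordinals below `η`. -/
noncomputable def blockSwap (η i x : Ordinal.{u}) : Ordinal.{u} :=
  if x < η ∧ i < leadingPower x then
    if x = leadingPower x + 1 then leadingPower x + i + 2
    else if x = leadingPower x + i + 2 then leadingPower x + 1 else x
  else x

variable {η i x : Ordinal.{u}}

theorem blockSwap_cases (η i x : Ordinal.{u}) : blockSwap η i x = x ∨
    x < η ∧ i < leadingPower x ∧
      (x = leadingPower x + 1 ∧ blockSwap η i x = leadingPower x + i + 2 ∨
        x = leadingPower x + i + 2 ∧ blockSwap η i x = leadingPower x + 1) := by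
  unfold blockSwap
  split_ifs with h₁ h₂ h₃
  · exact Or.inr ⟨h₁.1, h₁.2, Or.inl ⟨h₂, rfl⟩⟩
  · exact Or.inr ⟨h₁.1, h₁.2, Or.inr ⟨h₃, rfl⟩⟩
  · exact Or.inl rfl
  · exact Or.inl rfl

theorem blockSwap_ne_zero (hx : x ≠ 0) : blockSwap η i x ≠ 0 := by
  have hp := leadingPower_pos x
  rcases blockSwap_cases η i x with h | ⟨-, -, ⟨-, h⟩ | ⟨-, h⟩⟩
  · rwa [h]
  · rw [h]
    exact (hp.trans_le (le_self_add.trans le_self_add)).ne'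
  · rw [h]
    exact (hp.trans_le le_self_add).ne'

theorem leadingPower_blockSwap (η i x : Ordinal.{u}) :
    leadingPower (blockSwap η i x) = leadingPower x := by
  rcases blockSwap_cases η i x with h | ⟨-, hi, ⟨-, h⟩ | ⟨-, h⟩⟩
  · rw [h]
  · rw [h]
    exact leadingPower_add hi (natCast_lt_omega0 2)
  · rw [h]
    simpa using leadingPower_add (leadingPower_pos x) one_lt_omega0

theorem blockSwap_leadingPower_add_one (hi : i < leadingPower x) (hx : leadingPower x + 1 < η) :
    blockSwap η i (leadingPower x + 1) = leadingPower x + i + 2 := by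
  have e : leadingPower (leadingPower x + 1) = leadingPower x := by
    simpa using leadingPower_add (leadingPower_pos x) one_lt_omega0
  rw [blockSwap, e, if_pos ⟨hx, hi⟩, if_pos rfl]

theorem leadingPower_add_one_ne (i x : Ordinal.{u}) :
    leadingPower x + i + 2 ≠ leadingPower x + 1 := by
  rw [add_assoc]
  intro h
  have h' : i + 2 = 1 := add_left_cancel h
  have : (2 : Ordinal) ≤ 1 := h' ▸ le_add_self
  exact absurd this (by norm_num)

theorem blockSwap_leadingPower_add_add (hi : i < leadingPower x)
    (hx : leadingPower x + i + 2 < η) :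
    blockSwap η i (leadingPower x + i + 2) = leadingPower x + 1 := by
  have e : leadingPower (leadingPower x + i + 2) = leadingPower x :=
    leadingPower_add hi (natCast_lt_omega0 2)
  rw [blockSwap, e, if_pos ⟨hx, hi⟩, if_neg (leadingPower_add_one_ne i x), if_pos rfl]

theorem blockSwap_lt (hη : IsPrincipal (· + ·) η) (hω : ω ≤ η) (hx : x < η) :
    blockSwap η i x < η := by
  rcases blockSwap_cases η i x with h | ⟨-, hi, ⟨hx', h⟩ | ⟨hx', h⟩⟩
  · rwa [h]
  · rw [h]
    have hl : leadingPower x < η := (le_self_add.trans_eq hx'.symm).trans_lt hx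
    exact hη (hη hl (hi.trans hl)) ((natCast_lt_omega0 2).trans_le hω)
  · rw [h]
    have hl : leadingPower x < η :=
      ((le_self_add.trans le_self_add).trans_eq hx'.symm).trans_lt hx
    exact hη hl (one_lt_omega0.trans_le hω)

theorem blockSwap_blockSwap (hη : IsPrincipal (· + ·) η) (hω : ω ≤ η) (i x : Ordinal.{u}) :
    blockSwap η i (blockSwap η i x) = x := by
  rcases blockSwap_cases η i x with h | ⟨hx, hi, ⟨hx', h⟩ | ⟨hx', h⟩⟩
  · rw [h, h]
  · have := blockSwap_lt (i := i) hη hω hx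
    rw [h] at this ⊢
    rw [blockSwap_leadingPower_add_add hi this, ← hx']
  · have := blockSwap_lt (i := i) hη hω hx
    rw [h] at this ⊢
    rw [blockSwap_leadingPower_add_one hi this, ← hx']

/-- Only limit points matter, and these are fixed. At most two points of any block move, so near a
limit they can be avoided; a moved point of another block has its image in that same block, hence on
the correct side of the bound. -/
theorem continuous_blockSwap (η i : Ordinal.{u}) : Continuous (blockSwap η i) := by
  refine continuous_iff_continuousAt.2 fun x => ?_
  by_cases hx : Order.IsSuccLimit x
  swap
  · rw [ContinuousAt, SuccOrder.nhds_eq_pure.2 hx]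
    exact tendsto_pure_left.2 fun s hs => mem_of_mem_nhds hs
  have hne : ∀ y : Ordinal.{u}, y + 1 ≠ x := fun y h => by
    subst h
    exact Order.not_isSuccLimit_succ y hx
  have hne₂ : ∀ y : Ordinal.{u}, y + 2 ≠ x := fun y h => by
    refine hne (y + 1) ?_
    rw [← h, add_assoc, one_add_one_eq_two]
  have hself : blockSwap η i x = x := by
    rcases blockSwap_cases η i x with h | ⟨-, -, ⟨h, -⟩ | ⟨h, -⟩⟩
    exacts [h, (hne _ h.symm).elim, (hne₂ _ h.symm).elim]
  have hev : ∀ l : Ordinal.{u}, ∀ᶠ y in 𝓝 x, blockSwap η i y = y ∨ leadingPower y ≠ leadingPower l := by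
    intro l
    filter_upwards [isOpen_ne.mem_nhds (hne (leadingPower l)).symm,
      isOpen_ne.mem_nhds (hne₂ (leadingPower l + i)).symm] with y h₁ h₂
    rcases blockSwap_cases η i y with h | ⟨-, -, ⟨h, -⟩ | ⟨h, -⟩⟩
    · exact Or.inl h
    · exact Or.inr fun e => h₁ (by rw [← e]; exact h)
    · exact Or.inr fun e => h₂ (by rw [← e]; exact h)
  rw [ContinuousAt, hself]
  refine tendsto_order.2 ⟨fun l hl => ?_, fun u hu => ?_⟩
  · filter_upwards [Ioi_mem_nhds hl, hev l] with y hly hy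
    rcases hy with hy | hy
    · rwa [hy]
    · have := lt_of_leadingPower_lt ((leadingPower_mono (le_of_lt hly)).lt_of_ne hy.symm)
      rw [← leadingPower_blockSwap η i y] at this
      exact this.trans_le (leadingPower_le (blockSwap_ne_zero (ne_bot_of_gt hly)))
  · filter_upwards [Iio_mem_nhds (Order.lt_succ x), hev x] with y hyx hy
    refine lt_of_le_of_lt ?_ hu
    have hyx' : y ≤ x := Order.lt_succ_iff.1 (mem_Iio.1 hyx)
    rcases hy with hy | hy
    · rwa [hy]
    · have hlt := (leadingPower_mono hyx').lt_of_ne hy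
      rw [← leadingPower_blockSwap η i y] at hlt
      exact (lt_of_leadingPower_lt hlt).le.trans (leadingPower_le hx.ne_bot)

end BlockSwap

/-! ### Compact sets and isolated points of ordinals -/

section OrdinalSpaces

open Ordinal

theorem isCompact_setOf_val_le {o δ : Ordinal.{u}} (hδ : δ < o) :
    IsCompact {x : Iio o | x.1 ≤ δ} := by
  rw [Subtype.isCompact_iff]
  convert isCompact_Icc (a := (0 : Ordinal.{u})) (b := δ)
  ext x
  simp only [mem_image, mem_Icc, zero_le, true_and]
  exact ⟨fun ⟨y, hy, e⟩ => e ▸ hy, fun h => ⟨⟨x, h.trans_lt hδ⟩, h, rfl⟩⟩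

theorem exists_val_le_of_isCompact {o : Ordinal.{u}} (ho : 0 < o) {K : Set (Iio o)}
    (hK : IsCompact K) : ∃ δ < o, ∀ x ∈ K, x.1 ≤ δ := by
  rcases K.eq_empty_or_nonempty with rfl | hne
  · exact ⟨0, ho, by simp⟩
  · obtain ⟨y, hy, hmax⟩ := hK.exists_isMaxOn hne continuous_subtype_val.continuousOn
    exact ⟨y.1, y.2, hmax⟩

theorem isOpen_singleton_of_not_isSuccLimit {o : Ordinal.{u}} {x : Iio o}
    (hx : ¬ Order.IsSuccLimit x.1) : IsOpen {x} := by
  have := (SuccOrder.isOpen_singleton_iff.2 hx).preimage (continuous_subtype_val (p := (· ∈ Iio o)))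
  convert this
  ext y
  simp [Subtype.ext_iff]

/-- A limit ordinal contains a sequence of isolated points, of length its cofinality, that leaves
every compact set. -/
theorem exists_isolated_sequence {o b : Ordinal.{u}} {κ : Cardinal.{u}} (ho : Order.IsSuccLimit o)
    (hκ : o.cof = κ) (hb : b < o) :
    ∃ z : Iio κ.ord → Iio o, Function.Injective z ∧ (∀ i, IsOpen {z i}) ∧ (∀ i, b < (z i).1) ∧
      ∀ K, IsCompact K → ∃ γ < κ.ord, ∀ i, z i ∈ K → i.1 < γ := by
  subst hκ
  obtain ⟨f, hf⟩ := exists_isFundamentalSeq (o := o) rfl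
  have hp := isPrincipal_add_ord (aleph0_le_cof_iff.2 (one_lt_cof_iff.2 ho))
  obtain ⟨_, ⟨i₀, rfl⟩, hi₀⟩ := hf.isCofinal_range ⟨b, hb⟩
  -- Starting the fundamental sequence at `i₀` puts it above `b`; additive principality keeps the
  -- length unchanged. Taking successors below makes the points isolated.
  let t : Iio o.cof.ord → Iio o.cof.ord := fun i => ⟨i₀ + i, hp i₀.2 i.2⟩
  refine ⟨fun i => ⟨Order.succ (f (t i)).1, ho.succ_lt (f (t i)).2⟩, fun i j hij => ?_, fun i => ?_,
    fun i => ?_, fun K hK => ?_⟩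
  · have h₁ : t i = t j := hf.strictMono.injective
      (Subtype.ext (Order.succ_injective (Subtype.ext_iff.1 hij)))
    exact Subtype.ext (add_left_cancel (Subtype.ext_iff.1 h₁))
  · exact isOpen_singleton_of_not_isSuccLimit (Order.not_isSuccLimit_succ _)
  · have h₁ : f i₀ ≤ f (t i) := hf.strictMono.monotone
      (show i₀.1 ≤ i₀.1 + i.1 from le_self_add)
    exact Order.lt_succ_of_le (hi₀.trans h₁)
  · obtain ⟨δ, hδ, hKδ⟩ := exists_val_le_of_isCompact ho.bot_lt hK
    obtain ⟨_, ⟨j, rfl⟩, hj⟩ := hf.isCofinal_range ⟨δ, hδ⟩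
    refine ⟨j.1, j.2, fun i hi => ?_⟩
    have h₁ : f (t i) < f j := (Order.succ_le_iff.1 (hKδ _ hi) : (f (t i)).1 < δ).trans_le hj
    have h₂ : i₀.1 + i.1 < j.1 := hf.strictMono.lt_iff_lt.1 h₁
    exact le_add_self.trans_lt h₂

end OrdinalSpaces

/-! ### Necessity of the conditions -/

section Failure

open Ordinal

variable {X : Type (u + 1)} [TopologicalSpace X] [T1Space X]

theorem not_cshp_of_countable_sequence (z : Iio (ω : Ordinal.{u}) → X) (hz : Function.Injective z)
    (hzo : ∀ i, IsOpen {z i}) (hzK : ∀ K, IsCompact K → ∃ γ < ω, ∀ i, z i ∈ K → i.1 < γ) :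
    ¬ CSHP X := by
  refine not_cshp_of_isolated z hz hzo (fun _ => 1) (fun _ => one_mem _) (fun _ _ => rfl)
    (fun K hK => Or.inl ?_) fun V hV => ?_
  · obtain ⟨γ, hγ, h⟩ := hzK K hK
    obtain ⟨n, rfl⟩ := lt_omega0.1 hγ
    refine ((Set.finite_Iio n).image fun k : ℕ => (⟨k, natCast_lt_omega0 k⟩ : Iio ω)).subset ?_
    intro i hi
    obtain ⟨k, hk⟩ := lt_omega0.1 i.2
    have := h i hi
    rw [hk, Nat.cast_lt] at this
    exact ⟨k, this, Subtype.ext hk.symm⟩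
  · refine Set.infinite_of_injective_forall_mem
      (f := fun k : ℕ => (⟨k, natCast_lt_omega0 k⟩ : Iio (ω : Ordinal.{u}))) (fun k l h => ?_)
      fun k x => mem_of_mem_nhds (hV x)
    exact Nat.cast_injective (Subtype.ext_iff.1 h)

variable {α β η : Ordinal.{u}}

/-- The block involution as a homeomorphism of an ordinal. -/
noncomputable def blockSwapHomeo (hη : IsPrincipal (· + ·) η) (hω : ω ≤ η) (hβ : η ≤ β)
    (i : Ordinal.{u}) : Iio β ≃ₜ Iio β :=
  have hmem : ∀ x : Iio β, blockSwap η i x.1 < β := fun x => by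
    by_cases hx : x.1 < η
    · exact (blockSwap_lt hη hω hx).trans_le hβ
    · rcases blockSwap_cases η i x.1 with h | h
      · exact h.trans_lt x.2
      · exact (hx h.1).elim
  have hc : Continuous fun x : Iio β => (⟨blockSwap η i x.1, hmem x⟩ : Iio β) :=
    ((continuous_blockSwap η i).comp continuous_subtype_val).subtype_mk _
  { toFun := fun x => ⟨blockSwap η i x.1, hmem x⟩
    invFun := fun x => ⟨blockSwap η i x.1, hmem x⟩
    left_inv := fun x => Subtype.ext (blockSwap_blockSwap hη hω i x.1)
    right_inv := fun x => Subtype.ext (blockSwap_blockSwap hη hω i x.1)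
    continuous_toFun := hc
    continuous_invFun := hc }

/-- The `i`-th block involution moves only points below `κ.ord` in blocks whose power of `ω` exceeds
`i`. It therefore has compact support, fixes every `z j`, and tends to the identity as `i` grows. -/
theorem not_cshp_of_uncountable_sequence {κ : Cardinal.{u}} (hκ : Cardinal.aleph0 < κ)
    (hβ : κ.ord < β) (z : Iio κ.ord → Iio α ⊕ Iio β) (hz : Function.Injective z)
    (hzo : ∀ i, IsOpen {z i}) (hzκ : ∀ i x, z i = Sum.inr x → κ.ord < x.1)
    (hzK : ∀ K, IsCompact K → ∃ γ < κ.ord, ∀ i, z i ∈ K → i.1 < γ) :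
    ¬ CSHP (Iio α ⊕ Iio β) := by
  have hp := isPrincipal_add_ord hκ.le
  have hω : ω ≤ κ.ord := by simpa using Cardinal.ord_le_ord.2 hκ.le
  have hω' : ω < κ.ord := by simpa using Cardinal.ord_lt_ord.2 hκ
  let g : Iio κ.ord → (Iio α ⊕ Iio β ≃ₜ Iio α ⊕ Iio β) := fun i =>
    (Homeomorph.refl _).sumCongr (blockSwapHomeo hp hω hβ.le i.1)
  have hgl : ∀ i x, g i (Sum.inl x) = Sum.inl x := fun i x => rfl
  have hgr : ∀ i x, g i (Sum.inr x) = Sum.inr (blockSwapHomeo hp hω hβ.le i.1 x) := fun i x => rfl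
  have hval : ∀ i x, (blockSwapHomeo hp hω hβ.le i x).1 = blockSwap κ.ord i x.1 := fun i x => rfl
  have hge : ∀ (i : Ordinal) (x : Iio β), κ.ord ≤ x.1 → blockSwapHomeo hp hω hβ.le i x = x := by
    intro i x hx
    rcases blockSwap_cases κ.ord i x.1 with h | h
    · exact Subtype.ext h
    · exact (hx.not_gt h.1).elim
  refine not_cshp_of_isolated z hz hzo g (fun i => ?_) (fun i j => ?_) (fun K hK => Or.inr ?_)
    fun V hV => ?_
  · refine mem_iUnion.2 ⟨⟨Sum.inr '' {x : Iio β | x.1 ≤ κ.ord},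
      (isCompact_setOf_val_le hβ).image continuous_inr⟩, ?_⟩
    rintro (x | x) hx
    · rfl
    · rw [hgr, hge]
      exact le_of_not_ge fun h => hx ⟨x, h, rfl⟩
  · rcases hj : z j with x | x
    · rfl
    · rw [hgr, hge _ _ (hzκ j x hj).le]
  · obtain ⟨γ, hγ, hγK⟩ := hzK K hK
    -- Uncountability of `κ` enters here. Since `γ ≤ ω ^ γ`, all indices relevant to `K` act on this
    -- block, sending `ω ^ γ + 1` to distinct points.
    have hγ' : ω ^ γ < κ.ord := isPrincipal_opow_ord hκ.le hω' hγ
    have hlp : leadingPower (ω ^ γ) = ω ^ γ := by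
      rw [leadingPower, log_opow one_lt_omega0]
    have hf : ω ^ γ + 1 < κ.ord := hp hγ' (one_lt_omega0.trans hω')
    have hgf : ∀ i ∈ z ⁻¹' K, blockSwap κ.ord i.1 (ω ^ γ + 1) = ω ^ γ + i.1 + 2 := by
      intro i hi
      have hi' : i.1 < leadingPower (ω ^ γ) := by
        rw [hlp]
        exact (hγK i hi).trans_le (right_le_opow γ one_lt_omega0)
      simpa only [hlp] using blockSwap_leadingPower_add_one hi' (by rwa [hlp])
    refine ⟨Sum.inr ⟨ω ^ γ + 1, hf.trans hβ⟩, ?_, ?_, ?_⟩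
    · have := isOpen_singleton_of_not_isSuccLimit (o := β) (x := ⟨ω ^ γ + 1, hf.trans hβ⟩)
        (Order.not_isSuccLimit_succ _)
      simpa using isOpenMap_inr _ this
    · rintro i hi ⟨j, hj⟩
      refine (hzκ j _ (hj.trans (hgr _ _))).not_gt ?_
      rw [hval]
      exact blockSwap_lt hp hω hf
    · intro i hi j hj hij
      simp only [hgr, Sum.inr.injEq, Subtype.ext_iff, hval] at hij
      rw [hgf i hi, hgf j hj] at hij
      have h2 : (ω ^ γ + i.1 + ((2 : ℕ) : Ordinal)) = ω ^ γ + j.1 + ((2 : ℕ) : Ordinal) := hij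
      exact Subtype.ext (add_left_cancel (Ordinal.add_right_cancel 2 |>.1 h2))
  · let p : Iio β := ⟨κ.ord, hβ⟩
    have h₁ := hV (Sum.inr p)
    rw [nhds_prod_eq] at h₁
    obtain ⟨T, hT, hTV⟩ := mem_prod_self_iff.1 h₁
    have h₂ : Sum.inr ⁻¹' T ∈ 𝓝 p := continuous_inr.continuousAt.preimage_mem_nhds hT
    obtain ⟨T', hT', hTT'⟩ := mem_nhds_subtype _ _ _ |>.1 h₂
    obtain ⟨δ, hδ, hδT⟩ := exists_Ioc_subset_of_mem_nhds hT' ⟨0, omega0_pos.trans_le hω⟩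
    have hmem : ∀ x : Iio β, δ < x.1 → x.1 ≤ κ.ord → Sum.inr x ∈ T := fun x hx hx' =>
      hTT' (hδT ⟨hx, hx'⟩)
    have hlt : ∀ n : ℕ, δ + n < κ.ord := fun n => hp hδ ((natCast_lt_omega0 n).trans hω')
    refine Set.infinite_of_injective_forall_mem (f := fun n : ℕ => (⟨δ + n, hlt n⟩ : Iio κ.ord))
      (fun m n hmn => ?_) fun n => ?_
    · exact Nat.cast_injective (add_left_cancel (Subtype.ext_iff.1 hmn))
    · rintro (x | x)
      · exact mem_of_mem_nhds (hV _)
      · rw [hgr]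
        rcases blockSwap_cases κ.ord (δ + n) x.1 with h | ⟨hx, hi, hs⟩
        · rw [show blockSwapHomeo hp hω hβ.le (δ + n) x = x from Subtype.ext h]
          exact mem_of_mem_nhds (hV _)
        · have hx0 : x.1 ≠ 0 := by
            rcases hs with ⟨e, -⟩ | ⟨e, -⟩
            · exact ((leadingPower_pos _).trans_le (le_self_add.trans_eq e.symm)).ne'
            · exact ((leadingPower_pos _).trans_le
                ((le_self_add.trans le_self_add).trans_eq e.symm)).ne'
          have hδ' : δ < leadingPower x.1 := le_self_add.trans_lt hi
          refine hTV ⟨hmem _ (hδ'.trans_le (leadingPower_le hx0)) hx.le,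
            hmem _ ?_ (blockSwap_lt hp hω hx).le⟩
          refine (hδ'.trans_eq (leadingPower_blockSwap κ.ord (δ + n) x.1).symm).trans_le ?_
          exact leadingPower_le (blockSwap_ne_zero hx0)

theorem aleph0_lt_cof_of_cshp {o : Ordinal.{u}} (ho : Order.IsSuccLimit o) {e : Iio o → X}
    (he : IsOpenEmbedding e) (he' : IsClosedEmbedding e) (hX : CSHP X) :
    Cardinal.aleph0 < o.cof := by
  refine lt_of_le_of_ne (aleph0_le_cof_iff.2 (one_lt_cof_iff.2 ho)) fun hc => ?_
  have hseq := exists_isolated_sequence ho hc.symm ho.bot_lt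
  rw [Cardinal.ord_aleph0] at hseq
  obtain ⟨z, hz, hzo, -, hzK⟩ := hseq
  refine not_cshp_of_countable_sequence (e ∘ z) (he.injective.comp hz)
    (fun i => by simpa using he.isOpenMap _ (hzo i)) (fun K hK => ?_) hX
  exact hzK _ (he'.isCompact_preimage hK)

theorem isSuccLimit_of_not_isSuccessor {o : Ordinal.{u}} (ho : ω ≤ o) (h : ¬ IsSuccessor o) :
    Order.IsSuccLimit o := by
  refine Ordinal.isSuccLimit_iff.2 ⟨(omega0_pos.trans_le ho).ne', ?_⟩
  by_contra h'
  obtain ⟨γ, hγ⟩ := Order.not_isSuccPrelimit_iff_mem_range_succ.1 h'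
  exact h ⟨γ, hγ.symm⟩

theorem conditions_of_cshp (hα : ω ≤ α) (hαβ : α ≤ β) (hX : CSHP (Iio α ⊕ Iio β)) :
    (IsSuccessor α ∧ IsSuccessor β) ∨
      (IsUncountableRegularCardinal β ∧ (α = β ∨ IsSuccessor α)) := by
  have hα' : IsSuccessor α ∨ α = β := by
    refine or_iff_not_imp_left.2 fun hs => by_contra fun hne => ?_
    have hl := isSuccLimit_of_not_isSuccessor hα hs
    obtain ⟨z, hz, hzo, -, hzK⟩ := exists_isolated_sequence hl rfl hl.bot_lt
    -- Here `α` is a limit below `β`: the sequence escapes in `α`, while the involutions act on `β`.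
    refine not_cshp_of_uncountable_sequence
      (aleph0_lt_cof_of_cshp hl IsOpenEmbedding.inl IsClosedEmbedding.inl hX)
      ((ord_cof_le α).trans_lt (hαβ.lt_of_ne hne)) (Sum.inl ∘ z) (Sum.inl_injective.comp hz)
      (fun i => by simpa using isOpenMap_inl _ (hzo i)) (fun i x h => ?_) (fun K hK => ?_) hX
    · cases h
    · exact hzK _ (IsClosedEmbedding.inl.isCompact_preimage hK)
  by_cases hβs : IsSuccessor β
  · refine Or.inl ⟨?_, hβs⟩
    rcases hα' with h | rfl
    exacts [h, hβs]
  · have hl := isSuccLimit_of_not_isSuccessor (hα.trans hαβ) hβs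
    have hc := aleph0_lt_cof_of_cshp hl IsOpenEmbedding.inr IsClosedEmbedding.inr hX
    refine Or.inr ⟨⟨β.cof, hc, Cardinal.isRegular_cof hl, by_contra fun hne => ?_⟩, hα'.symm⟩
    have hlt : β.cof.ord < β := (ord_cof_le β).lt_of_ne (Ne.symm hne)
    -- The sequence starts beyond `β.cof.ord`, where the involutions are trivial.
    obtain ⟨z, hz, hzo, hzb, hzK⟩ := exists_isolated_sequence hl rfl hlt
    refine not_cshp_of_uncountable_sequence hc hlt (Sum.inr ∘ z) (Sum.inr_injective.comp hz)
      (fun i => by simpa using isOpenMap_inr _ (hzo i)) (fun i x h => ?_) (fun K hK => ?_) hX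
    · rw [← Sum.inr_injective h]
      exact hzb i
    · exact hzK _ (IsClosedEmbedding.inr.isCompact_preimage hK)

end Failure

/-! ### Neighbourhoods given by finitely many cuts; the compact case -/

section Cuts

open Ordinal

variable {α β : Ordinal.{u}}

/-- Two points of a sum of ordinals lie on the same side of all the cuts given by `F`. -/
def SameSide (F : Finset (Iio α ⊕ Iio β)) (x y : Iio α ⊕ Iio β) : Prop :=
  x.isLeft = y.isLeft ∧ ∀ a ∈ F, x ≤ a ↔ y ≤ a

theorem SameSide.mono {F G : Finset (Iio α ⊕ Iio β)} (h : F ⊆ G) {x y : Iio α ⊕ Iio β}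
    (hxy : SameSide G x y) : SameSide F x y :=
  ⟨hxy.1, fun a ha => hxy.2 a (h ha)⟩

theorem isClopen_Iic_Iio (o : Ordinal.{u}) (a : Iio o) : IsClopen (Iic a) := by
  refine ⟨isClosed_Iic, ?_⟩
  have : Iic a = Subtype.val ⁻¹' Iio (Order.succ a.1) := by
    ext x
    simp [← Subtype.coe_le_coe]
  rw [this]
  exact isOpen_Iio.preimage continuous_subtype_val

/-- The order is that of the disjoint sum, so the set below `a` is an initial segment of one
summand. -/
theorem isClopen_setOf_le_sum (a : Iio α ⊕ Iio β) : IsClopen {x : Iio α ⊕ Iio β | x ≤ a} := by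
  rw [IsClopen, isClosed_sum_iff, isOpen_sum_iff]
  rcases a with a | a
  · have h := isClopen_Iic_Iio α a
    simp only [preimage_ofPred_eq, Sum.inl_le_inl_iff, Sum.not_inr_le_inl]
    exact ⟨⟨h.1, by simp⟩, h.2, by simp⟩
  · have h := isClopen_Iic_Iio β a
    simp only [preimage_ofPred_eq, Sum.inr_le_inr_iff, Sum.not_inl_le_inr]
    exact ⟨⟨by simp, h.1⟩, by simp, h.2⟩

theorem sameSide_mem_nhds (F : Finset (Iio α ⊕ Iio β)) (h₀ : HomeoCpt (Iio α ⊕ Iio β)) :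
    {h : HomeoCpt (Iio α ⊕ Iio β) | ∀ x, SameSide F (h.1 x) (h₀.1 x)} ∈
      @nhds _ (stoneCechTopology (Iio α ⊕ Iio β)) h₀ := by
  have h₁ := setOf_mem_iff_mem_nhds h₀ (isClopen_range_inl (X := Iio α) (Y := Iio β))
  have h₂ := (Filter.biInter_finset_mem F).2 fun a _ =>
    setOf_mem_iff_mem_nhds h₀ (isClopen_setOf_le_sum a)
  filter_upwards [h₁, h₂] with h hh₁ hh₂ x
  refine ⟨?_, fun a ha => mem_iInter₂.1 hh₂ a ha x⟩
  rw [Bool.eq_iff_iff]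
  have hr : ∀ y : Iio α ⊕ Iio β, y.isLeft = true ↔ y ∈ range Sum.inl := by
    rintro (y | y) <;> simp
  rw [hr, hr]
  exact hh₁ x

theorem exists_cuts_of_mem_nhds {o : Ordinal.{u}} {a : Iio o} {S : Set (Iio o)} (hS : S ∈ 𝓝 a) :
    ∃ t ∈ 𝓝 a, ∃ F : Finset (Iio o), ∀ x ∈ t, ∀ y, (∀ b ∈ F, y ≤ b ↔ x ≤ b) → y ∈ S := by
  classical
  have hIic := (isClopen_Iic_Iio o a).2.mem_nhds self_mem_Iic
  by_cases ha : ∃ l, l < a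
  · obtain ⟨l, hl, hlS⟩ := exists_Ioc_subset_of_mem_nhds hS ha
    refine ⟨Ioi l ∩ Iic a, inter_mem (Ioi_mem_nhds hl) hIic, {l, a}, fun x hx y h => hlS ⟨?_, ?_⟩⟩
    · exact lt_of_not_ge fun hy => hx.1.not_ge ((h l (by simp)).1 hy)
    · exact (h a (by simp)).2 hx.2
  · refine ⟨Iic a, hIic, {a}, fun x hx y h => ?_⟩
    have hya : y ≤ a := (h a (by simp)).2 hx
    rw [hya.eq_of_not_lt fun hlt => ha ⟨y, hlt⟩]
    exact mem_of_mem_nhds hS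

theorem exists_sameSide_of_isCompact {C O : Set (Iio α ⊕ Iio β)} (hC : IsCompact C) (hO : IsOpen O)
    (hCO : C ⊆ O) : ∃ F, ∀ x ∈ C, ∀ y, SameSide F y x → y ∈ O := by
  classical
  refine hC.induction_on (p := fun s => ∃ F, ∀ x ∈ s, ∀ y, SameSide F y x → y ∈ O) ⟨∅, by simp⟩
    ?_ ?_ ?_
  · rintro s t hst ⟨F, hF⟩
    exact ⟨F, fun x hx => hF x (hst hx)⟩
  · rintro s t ⟨F, hF⟩ ⟨G, hG⟩
    refine ⟨F ∪ G, ?_⟩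
    rintro x (hx | hx) y hy
    · exact hF x hx y (hy.mono Finset.subset_union_left)
    · exact hG x hx y (hy.mono Finset.subset_union_right)
  · rintro (a | a) ha
    · obtain ⟨t, ht, F, hF⟩ := exists_cuts_of_mem_nhds
        (continuous_inl.continuousAt.preimage_mem_nhds (hO.mem_nhds (hCO ha)))
      refine ⟨Sum.inl '' t, mem_nhdsWithin_of_mem_nhds (isOpenMap_inl.image_mem_nhds ht),
        F.image Sum.inl, ?_⟩
      rintro _ ⟨x, hx, rfl⟩ (y | y) ⟨h₁, h₂⟩
      · refine hF x hx y fun b hb => ?_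
        simpa using h₂ (Sum.inl b) (Finset.mem_image_of_mem _ hb)
      · simp at h₁
    · obtain ⟨t, ht, F, hF⟩ := exists_cuts_of_mem_nhds
        (continuous_inr.continuousAt.preimage_mem_nhds (hO.mem_nhds (hCO ha)))
      refine ⟨Sum.inr '' t, mem_nhdsWithin_of_mem_nhds (isOpenMap_inr.image_mem_nhds ht),
        F.image Sum.inr, ?_⟩
      rintro _ ⟨x, hx, rfl⟩ (y | y) ⟨h₁, h₂⟩
      · simp at h₁
      · refine hF x hx y fun b hb => ?_
        simpa using h₂ (Sum.inr b) (Finset.mem_image_of_mem _ hb)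

/-- In the group of homeomorphisms supported in `K`, respecting finitely many cuts forces a
homeomorphism into a given neighbourhood. -/
theorem exists_sameSide_of_isOpen {K : Set (Iio α ⊕ Iio β)} {U : Set (HomeoOn K)}
    (hU : IsOpen[homeoOnTopology K] U) {h₀ : HomeoOn K} (hh₀ : h₀ ∈ U) :
    ∃ F, ∀ h : HomeoOn K, (∀ x, SameSide F (h.1 x) (h₀.1 x)) → h ∈ U := by
  classical
  let := compactOpen (Iio α ⊕ Iio β)
  let := homeoOnTopology K
  let s : Finset (Iio α ⊕ Iio β) → Set (HomeoOn K) := fun F =>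
    {h | ∀ x, SameSide F (h.1 x) (h₀.1 x)}
  have hs : (⨅ F, 𝓟 (s F)).HasBasis (fun _ => True) s :=
    hasBasis_iInf_principal fun F G => ⟨F ∪ G, fun h hh x => (hh x).mono Finset.subset_union_left,
      fun h hh x => (hh x).mono Finset.subset_union_right⟩
  have hle : (⨅ F, 𝓟 (s F)) ≤ 𝓝 h₀ := by
    rw [nhds_induced, ← tendsto_iff_comap, nhds_induced]
    refine tendsto_comap_iff.2 (ContinuousMap.tendsto_nhds_compactOpen.2 fun C hC O hO hCO => ?_)
    -- The cuts are chosen for the compact image of `C` under `h₀`, because `h` and `h₀` are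
    -- compared in the target.
    obtain ⟨F, hF⟩ := exists_sameSide_of_isCompact (hC.image h₀.1.continuous) hO hCO.image_subset
    filter_upwards [hs.mem_of_mem (i := F) trivial] with h hh x hx
    exact hF _ (mem_image_of_mem _ hx) _ (hh x)
  obtain ⟨F, -, hF⟩ := hs.mem_iff.1 (hle (hU.mem_nhds hh₀))
  exact ⟨F, fun h hh => hF hh⟩

theorem cshp_of_forall_sameSide
    (H : ∀ U : Set (HomeoCpt (Iio α ⊕ Iio β)), IsOpen[colimTopology _] U → ∀ h₀ ∈ U,
      ∃ F, ∀ h : HomeoCpt (Iio α ⊕ Iio β), (∀ x, SameSide F (h.1 x) (h₀.1 x)) → h ∈ U) :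
    CSHP (Iio α ⊕ Iio β) := by
  refine le_antisymm colimTopology_le_stoneCechTopology fun U hU => ?_
  let := stoneCechTopology (Iio α ⊕ Iio β)
  refine isOpen_iff_mem_nhds.2 fun h₀ hh₀ => ?_
  obtain ⟨F, hF⟩ := H U hU h₀ hh₀
  exact mem_of_superset (sameSide_mem_nhds F h₀) hF

theorem isOpen_incl_preimage {X : Type*} [TopologicalSpace X] {U : Set (HomeoCpt X)}
    (hU : IsOpen[colimTopology X] U) (K : TopologicalSpace.Compacts X) :
    IsOpen[homeoOnTopology (K : Set X)] (incl K ⁻¹' U) := by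
  simp only [isOpen_iSup_iff, isOpen_coinduced] at hU
  exact hU K

theorem compactSpace_Iio_of_isSuccessor {o : Ordinal.{u}} (ho : IsSuccessor o) :
    CompactSpace (Iio o) := by
  obtain ⟨γ, rfl⟩ := ho
  refine ⟨?_⟩
  convert isCompact_setOf_val_le (Order.lt_succ γ)
  ext x
  simpa using Order.lt_succ_iff.1 x.2

theorem cshp_of_isSuccessor (hα : IsSuccessor α) (hβ : IsSuccessor β) :
    CSHP (Iio α ⊕ Iio β) := by
  have := compactSpace_Iio_of_isSuccessor hα
  have := compactSpace_Iio_of_isSuccessor hβ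
  refine cshp_of_forall_sameSide fun U hU h₀ hh₀ => ?_
  have hmem : ∀ h : Iio α ⊕ Iio β ≃ₜ Iio α ⊕ Iio β,
      h ∈ HomeoOn ((⊤ : TopologicalSpace.Compacts (Iio α ⊕ Iio β)) : Set _) := fun h x hx =>
    (hx trivial).elim
  obtain ⟨F, hF⟩ := exists_sameSide_of_isOpen (isOpen_incl_preimage hU ⊤)
    (h₀ := ⟨h₀.1, hmem h₀.1⟩) hh₀
  exact ⟨F, fun h hh => hF ⟨h.1, hmem h.1⟩ hh⟩

end Cuts

/-! ### Sufficiency for uncountable regular cardinals -/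

section Regular

open Ordinal

variable {α β : Ordinal.{u}}

/-- The ordinal underlying a point of a sum of two ordinals. -/
def height : Iio α ⊕ Iio β → Ordinal.{u} :=
  Sum.elim Subtype.val Subtype.val

theorem isCompact_setOf_height_le {δ : Ordinal.{u}} (hα : α = β ∨ IsSuccessor α) (hδ : δ < β) :
    IsCompact {x : Iio α ⊕ Iio β | height x ≤ δ} := by
  have hl : IsCompact {x : Iio α | x.1 ≤ δ} := by
    rcases hα with rfl | hα
    · exact isCompact_setOf_val_le hδ
    · have := compactSpace_Iio_of_isSuccessor hα
      exact (isClosed_Iic.preimage continuous_subtype_val).isCompact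
  convert (hl.image continuous_inl).union ((isCompact_setOf_val_le hδ).image continuous_inr)
  ext (x | x) <;> simp [height]

theorem exists_height_le_of_isCompact (hαβ : α ≤ β) (hα : 0 < α) {K : Set (Iio α ⊕ Iio β)}
    (hK : IsCompact K) : ∃ δ < β, ∀ x ∈ K, height x ≤ δ := by
  obtain ⟨δ₁, h₁, hK₁⟩ := exists_val_le_of_isCompact hα (IsClosedEmbedding.inl.isCompact_preimage hK)
  obtain ⟨δ₂, h₂, hK₂⟩ :=
    exists_val_le_of_isCompact (hα.trans_le hαβ) (IsClosedEmbedding.inr.isCompact_preimage hK)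
  refine ⟨max δ₁ δ₂, max_lt (h₁.trans_le hαβ) h₂, ?_⟩
  rintro (x | x) hx
  · exact (hK₁ x hx).trans (le_max_left _ _)
  · exact (hK₂ x hx).trans (le_max_right _ _)

/-- This count lets regularity bound the supports of all homeomorphisms chosen for cuts up to `δ`.
-/
theorem mk_finset_height_le_lt {κ : Cardinal.{u}} (hκ : Cardinal.aleph0 < κ) {δ : Ordinal.{u}}
    (hδ : δ < κ.ord) :
    Cardinal.mk {F : Finset (Iio α ⊕ Iio β) // ∀ a ∈ F, height a ≤ δ} <
      Cardinal.lift.{u + 1} κ := by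
  classical
  let S := {x : Iio α ⊕ Iio β // height x ≤ δ}
  have hκ' : Cardinal.aleph0 < Cardinal.lift.{u + 1} κ := Cardinal.aleph0_lt_lift.2 hκ
  have hS : Cardinal.mk S < Cardinal.lift.{u + 1} κ := by
    let φ : S → (ULift.{u + 1} Bool) × Iio (Order.succ δ) := fun x =>
      (⟨x.1.isLeft⟩, ⟨height x.1, Order.lt_succ_of_le x.2⟩)
    have hφ : Function.Injective φ := by
      rintro ⟨x | x, hx⟩ ⟨y | y, hy⟩ h <;> simp [φ, height] at h
      · exact Subtype.ext (congrArg Sum.inl (Subtype.ext h))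
      · exact Subtype.ext (congrArg Sum.inr (Subtype.ext h))
    refine (Cardinal.mk_le_of_injective hφ).trans_lt ?_
    rw [Cardinal.mk_prod, Cardinal.lift_id, Cardinal.lift_id, Cardinal.mk_Iio_ordinal]
    refine Cardinal.mul_lt_of_lt hκ'.le ((Cardinal.mk_lt_aleph0).trans hκ') ?_
    rw [Cardinal.lift_lt, ← Cardinal.lt_ord]
    exact (Cardinal.isSuccLimit_ord hκ.le).succ_lt hδ
  have hF : Cardinal.mk (Finset S) < Cardinal.lift.{u + 1} κ := by
    rcases finite_or_infinite S with h | h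
    · exact (Cardinal.mk_lt_aleph0).trans hκ'
    · rwa [Cardinal.mk_finset_of_infinite]
  refine lt_of_le_of_lt (Cardinal.mk_le_of_surjective (f := fun G : Finset S =>
    (⟨G.map (Function.Embedding.subtype _), fun a ha => ?_⟩ :
      {F : Finset (Iio α ⊕ Iio β) // ∀ a ∈ F, height a ≤ δ})) ?_) hF
  · obtain ⟨x, -, rfl⟩ := Finset.mem_map.1 ha
    exact x.2
  · rintro ⟨F, hF⟩
    exact ⟨F.subtype _, Subtype.ext (Finset.subtype_map_of_mem hF)⟩

theorem apply_mem_of_mem_homeoOn {X : Type*} [TopologicalSpace X] {K : Set X} {h : X ≃ₜ X}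
    (hh : h ∈ HomeoOn K) {x : X} (hx : x ∈ K) : h x ∈ K := by
  by_contra hK
  have := h.injective (hh _ hK)
  rw [this] at hK
  exact hK hx

theorem homeoOn_mono {X : Type*} [TopologicalSpace X] {K L : Set X} (hKL : K ⊆ L) :
    HomeoOn K ≤ HomeoOn L :=
  fun _ hh x hx => hh x fun h => hx (hKL h)

theorem cshp_of_isUncountableRegularCardinal (h0 : 0 < α) (hαβ : α ≤ β)
    (hβ : IsUncountableRegularCardinal β) (hα : α = β ∨ IsSuccessor α) :
    CSHP (Iio α ⊕ Iio β) := by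
  classical
  obtain ⟨κ, hκ, hreg, hβκ⟩ := hβ
  have hcof : β.cof = κ := by rw [hβκ, hreg.cof_ord]
  refine cshp_of_forall_sameSide fun U hU h₀ hh₀ => ?_
  by_contra! hcon
  choose h hside hnot using hcon
  have hsupp : ∀ h : HomeoCpt (Iio α ⊕ Iio β),
      ∃ δ < β, h.1 ∈ HomeoOn {x : Iio α ⊕ Iio β | height x ≤ δ} := fun h => by
    obtain ⟨K, hK⟩ := mem_iUnion.1 h.2
    obtain ⟨δ, hδ, hKδ⟩ := exists_height_le_of_isCompact hαβ h0 K.isCompact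
    exact ⟨δ, hδ, homeoOn_mono hKδ hK⟩
  choose supp hsupp_lt hsupp using hsupp
  let bound : Ordinal.{u} → Set Ordinal.{u} := fun δ =>
    range fun F : {F : Finset (Iio α ⊕ Iio β) // ∀ a ∈ F, height a ≤ δ} => supp (h F.1)
  have hbdd : ∀ δ, BddAbove (bound δ) := fun δ => ⟨β, by
    rintro _ ⟨F, rfl⟩
    exact (hsupp_lt _).le⟩
  let step : Ordinal.{u} → Ordinal.{u} := fun δ => sSup (bound δ)
  have hstep : ∀ δ < β, step δ < β := fun δ hδ => by
    refine sSup_lt_of_lt_cof ?_ ?_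
    · rw [← lift_cof, hcof]
      exact Cardinal.mk_range_le.trans_lt (mk_finset_height_le_lt hκ (hβκ ▸ hδ))
    · rintro _ ⟨F, rfl⟩
      exact hsupp_lt _
  -- Uncountable cofinality keeps this closure point below `β`; starting at the successor puts `supp
  -- h₀` strictly below it.
  let γ := nfp step (Order.succ (supp h₀))
  have hγ : γ < β := by
    refine nfp_lt_ord (hcof ▸ hκ) hstep ?_
    rw [hβκ]
    exact (Cardinal.isSuccLimit_ord hκ.le).succ_lt (hβκ ▸ hsupp_lt h₀)
  have hγ₀ : supp h₀ < γ := (Order.lt_succ _).trans_le (le_nfp _ _)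
  let K : TopologicalSpace.Compacts (Iio α ⊕ Iio β) := ⟨_, isCompact_setOf_height_le hα hγ⟩
  have hK₀ : h₀.1 ∈ HomeoOn (K : Set (Iio α ⊕ Iio β)) :=
    homeoOn_mono (fun x hx => le_trans hx hγ₀.le) (hsupp h₀)
  obtain ⟨F, hF⟩ := exists_sameSide_of_isOpen (isOpen_incl_preimage hU K) (h₀ := ⟨h₀.1, hK₀⟩) hh₀
  -- Being finite, `G` lies below some iterate of `step`, so the counterexample chosen for `G` is
  -- supported in `K`.
  let G := F.filter fun a => height a < γ
  have hG : G.sup height < γ :=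
    (Finset.sup_lt_iff (bot_le.trans_lt hγ₀)).2 fun a ha => (Finset.mem_filter.1 ha).2
  obtain ⟨n, hn⟩ := lt_nfp_iff.1 hG
  have hsuppG : supp (h G) ≤ γ := by
    have h₁ : supp (h G) ≤ step (step^[n] (Order.succ (supp h₀))) :=
      le_csSup (hbdd _) ⟨⟨G, fun a ha => (Finset.le_sup ha).trans hn.le⟩, rfl⟩
    rw [← Function.iterate_succ_apply' step] at h₁
    exact h₁.trans (iterate_le_nfp _ _ _)
  have hKG : (h G).1 ∈ HomeoOn (K : Set (Iio α ⊕ Iio β)) :=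
    homeoOn_mono (fun x hx => le_trans hx hsuppG) (hsupp (h G))
  refine hnot G (hF ⟨(h G).1, hKG⟩ fun x => ⟨(hside G x).1, fun a ha => ?_⟩)
  -- A cut at height at least `γ` only detects the summand of a point of `K`, so discarding it from
  -- `F` loses nothing.
  by_cases haγ : height a < γ
  · exact (hside G x).2 a (Finset.mem_filter.2 ⟨ha, haγ⟩)
  by_cases hx : x ∈ (K : Set (Iio α ⊕ Iio β))
  · have hle : ∀ y ∈ (K : Set (Iio α ⊕ Iio β)), y ≤ a ↔ y.isLeft = a.isLeft := by
      intro y hy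
      have hya : height y ≤ height a := le_trans hy (not_lt.1 haγ)
      rcases y with y | y <;> rcases a with a | a <;> simp
      · exact hya
      · exact hya
    rw [hle _ (apply_mem_of_mem_homeoOn hKG hx), hle _ (apply_mem_of_mem_homeoOn hK₀ hx),
      (hside G x).1]
  · rw [show (h G).1 x = x from hKG x hx, show h₀.1 x = x from hK₀ x hx]

end Regular

end CSHPDefs

/-- An ordinal `α` is regarded as the space `Set.Iio α` of all smaller ordinals; its subspace
topology in `Ordinal` is its order topology (`orderTopology_of_ordConnected`). The disjoint union
carries the sum topology. -/
theorem mainTheorem7 (α β : Ordinal.{u}) (hα : Ordinal.omega0 ≤ α) (hαβ : α ≤ β) :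
    CSHPDefs.CSHP (Set.Iio α ⊕ Set.Iio β) ↔
      (CSHPDefs.IsSuccessor α ∧ CSHPDefs.IsSuccessor β) ∨
      (CSHPDefs.IsUncountableRegularCardinal β ∧ (α = β ∨ CSHPDefs.IsSuccessor α)) := by
  refine ⟨CSHPDefs.conditions_of_cshp hα hαβ, ?_⟩
  rintro (⟨h₁, h₂⟩ | ⟨h₁, h₂⟩)
  · exact CSHPDefs.cshp_of_isSuccessor h₁ h₂
  · exact CSHPDefs.cshp_of_isUncountableRegularCardinal (Ordinal.omega0_pos.trans_le hα) hαβ h₁ h₂
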